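/- Let $\mathbb{F}$ be a finite field with $q$ elements and let $n>4$ be an odd integer. Let $O^n_q$ be the orthogonality graph: the simple graph whose vertices are the points $[x]$ of the projective space $(\mathbb{F}^n\setminus\{0\})/\mathbb{F}^*$, in which two distinct vertices $[x]$ and $[y]$ are adjacent if and only if $x_1y_1+\dots+x_ny_n=0$. Then the independence number of $O^n_q$ satisfies $$\alpha(O^n_q)\leq q^{n/2}-q+\sqrt{q}+2.$$ -/

import Mathlib

open scoped LinearAlgebra.Projectivization

/-- The orthogonality graph on the projective points of `F ^ n`: two distinct points
`[x]`, `[y]` are adjacent if and only if `x₁ y₁ + ⋯ + xₙ yₙ = 0`. -/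
def orthogonalityGraph (F : Type*) [Field F] (n : ℕ) : SimpleGraph (ℙ F (Fin n → F)) where
  Adj v w := v ≠ w ∧ Projectivization.orthogonal v w
  symm := ⟨fun _ _ h => ⟨h.1.symm, Projectivization.orthogonal_comm.mp h.2⟩⟩
  loopless := ⟨fun _ h => h.1 rfl⟩

theorem orthogonalityGraph_adj_mk {F : Type*} [Field F] {n : ℕ} {x y : Fin n → F}
    (hx : x ≠ 0) (hy : y ≠ 0) :
    (orthogonalityGraph F n).Adj (Projectivization.mk F x hx) (Projectivization.mk F y hy) ↔
      Projectivization.mk F x hx ≠ Projectivization.mk F y hy ∧ ∑ i, x i * y i = 0 :=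
  Iff.rfl

/-- Over a finite field the vertex set is finite, so the independence number is the size of
an actual largest independent set. -/
theorem orthogonalityGraph_exists_indepNum (F : Type*) [Field F] [Fintype F] (n : ℕ) :
    ∃ s, (orthogonalityGraph F n).IsNIndepSet (orthogonalityGraph F n).indepNum s := by
  classical
  have : Fintype (ℙ F (Fin n → F)) := Fintype.ofFinite _
  exact SimpleGraph.exists_isNIndepSet_indepNum

/-!
Write `r = √q`, and let `S` be an independent set with `a` isotropic points (points `[x]` with
`x ⬝ᵥ x = 0`). The relation `x ⬝ᵥ y = 0` on the projective points, *with* its loops at the isotropic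
points, is the incidence relation of a symmetric design: every point has `k` neighbours, two
points have `l` common ones, and the eigenvalues other than `k` are `± μ` with
`μ ^ 2 = k - l = q ^ (n - 2)`. Hoffman's ratio bound, in a form where each loop inside `S` costs one
unit (`independent_set_weighted_ratio_bound`), gives

  `#S ^ 2 * (μ + 1) ≤ (q * μ + 1) * (μ * #S + a)`.

With `a ≤ #S` this only yields `#S ≤ q * μ + 1 = q ^ (n / 2) + 1`, so a better bound on `a` is needed.
For odd `n`, the isotropic points alone again form a symmetric design under orthogonality, now with
`μ' = q ^ ((n - 3) / 2)` and all loops present; the same ratio bound gives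
`a ≤ q ^ ((n - 1) / 2) + 1 = r * μ + 1`
(`card_le_of_isotropic_of_pairwise_dotProduct_ne_zero`). Inserting this into the inequality
above proves the claim, by elementary algebra (`le_of_sq_mul_le_of_le`).

The design parameters come from counting vectors. If a condition `P` is invariant under translation
by the multiples of `v`, and each translation orbit meets `φ` exactly once, then one in `q` of the
vectors with `P` satisfies `φ` (`card_mul_card_filter_eq_of_existsUnique_smul_add`). This counts
the solutions of linear equations, and also the isotropic vectors orthogonal to given isotropic
ones, once the number `q ^ (n - 1)` of all isotropic vectors is known. In characteristic two
the latter form a hyperplane. In odd characteristic they are counted by the sums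
`∑ x, ψ (t * x ^ 2)`, which change sign when `t` is multiplied by a nonsquare, so that their odd
`n`-th powers cancel over `t ≠ 0`.
-/

open Finset

/-! ### A ratio bound with loops -/

/-- **Ratio bound** for a set `S` of points whose only `R`-related pairs are loops, in a set `Z` on which
`R` behaves like a symmetric design with parameters `(#Z, k, l)`. For `c` suitable, the inequality is
`0 ≤ ∑ z ∈ Z, (t z + μ * 1_S z - c) ^ 2`, where `t z` is the number of elements of `S` related to
`z`. -/
theorem independent_set_weighted_ratio_bound {α : Type*} (Z S : Finset α) (hSZ : S ⊆ Z)
    (R : α → α → Prop) [DecidableRel R] {k l μ : ℝ} (hμ : 0 < μ)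
    (hk : ∀ p ∈ S, (#{z ∈ Z | R p z} : ℝ) = k)
    (hl : ∀ p ∈ S, ∀ r ∈ S, p ≠ r → (#{z ∈ Z | R p z ∧ R r z} : ℝ) = l)
    (hS : ∀ p ∈ S, ∀ r ∈ S, p ≠ r → ¬ R p r)
    (hkl : k - l = μ ^ 2) (hdesign : k ^ 2 = l * #Z + μ ^ 2) :
    (#S : ℝ) ^ 2 * (k + μ) ≤ #Z * (μ * #S + #{p ∈ S | R p p}) := by
  classical
  set t : α → ℝ := fun z => ∑ p ∈ S, if R p z then 1 else 0 with ht
  set w : α → ℝ := fun z => if z ∈ S then 1 else 0 with hw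
  rcases S.eq_empty_or_nonempty with rfl | hne
  · simp
  have hN : (0 : ℝ) < #Z := by exact_mod_cast (hne.mono hSZ).card_pos
  have sum_t : ∑ z ∈ Z, t z = #S * k := by
    rw [ht, sum_comm]
    simp_rw [sum_boole]
    rw [sum_congr rfl hk]; simp
  have sum_tt : ∑ z ∈ Z, t z ^ 2 = #S * (k + (#S - 1) * l) := by
    have key : ∀ p ∈ S, ∑ r ∈ S, ∑ z ∈ Z,
        ((if R p z then 1 else 0) * (if R r z then 1 else 0) : ℝ) = k + (#S - 1) * l := by
      intro p hp
      rw [← add_sum_erase S _ hp]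
      congr 1
      · rw [← hk p hp, ← sum_boole]
        exact sum_congr rfl fun z _ => by split_ifs <;> simp
      · rw [sum_congr rfl (g := fun _ => l)]
        · rw [sum_const, card_erase_of_mem hp, nsmul_eq_mul, Nat.cast_pred hne.card_pos]
        · intro r hr
          rw [← hl p hp r (mem_of_mem_erase hr) (ne_of_mem_erase hr).symm, ← sum_boole]
          exact sum_congr rfl fun z _ => by split_ifs <;> simp_all
    simp_rw [ht, sq, sum_mul_sum]
    rw [sum_comm, sum_congr rfl (g := fun _ => k + (#S - 1) * l)]
    · rw [sum_const, nsmul_eq_mul]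
    · intro p hp
      rw [sum_comm, key p hp]
  have sum_w : ∑ z ∈ Z, w z = #S := by
    rw [hw, sum_boole, filter_mem_eq_inter, inter_eq_right.2 hSZ]
  have sum_ww : ∑ z ∈ Z, w z ^ 2 = #S := by
    rw [← sum_w]
    exact sum_congr rfl fun z _ => by simp [hw]
  have sum_tw : ∑ z ∈ Z, t z * w z = #{p ∈ S | R p p} := by
    simp only [hw, mul_ite, mul_one, mul_zero, ← sum_filter]
    rw [filter_mem_eq_inter, inter_eq_right.2 hSZ, ← sum_boole]
    refine sum_congr rfl fun p hp => ?_
    exact sum_eq_single_of_mem p hp fun r hr hrp => if_neg (hS r hr p hp hrp)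
  -- This `c` is the mean of `t + μ * w` over `Z`, which minimises the sum of squares.
  set c : ℝ := #S * (k + μ) / #Z with hc
  have hcN : c * #Z = #S * (k + μ) := by rw [hc]; field_simp
  have expand : ∑ z ∈ Z, (t z + μ * w z - c) ^ 2 =
      #S * (k + (#S - 1) * l) + μ ^ 2 * #S + c ^ 2 * #Z + 2 * μ * #{p ∈ S | R p p}
        - 2 * c * (#S * k) - 2 * c * μ * #S := by
    rw [← sum_tt, ← sum_tw, ← sum_t]
    nth_rewrite 1 [← sum_ww]
    rw [← sum_w]
    have : (c ^ 2 * #Z : ℝ) = ∑ _z ∈ Z, c ^ 2 := by simp [mul_comm]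
    rw [this]
    simp only [mul_sum, ← sum_add_distrib, ← sum_sub_distrib]
    exact sum_congr rfl fun z _ => by ring
  have hpos : 0 ≤ ∑ z ∈ Z, (t z + μ * w z - c) ^ 2 := sum_nonneg fun _ _ => sq_nonneg _
  rw [expand] at hpos
  have h1 : 0 ≤ 2 * μ * (μ * #S + #{p ∈ S | R p p}) + #S ^ 2 * l - c * (#S * (k + μ)) := by
    have e1 : c ^ 2 * #Z = c * (#S * (k + μ)) := by rw [sq, mul_assoc, hcN]
    have e2 : (#S : ℝ) * k = #S * l + #S * μ ^ 2 := by rw [← hkl]; ring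
    linarith
  have h2 := mul_nonneg h1 hN.le
  have h3 : (c * (#S * (k + μ))) * #Z = (#S * (k + μ)) ^ 2 := by
    rw [mul_right_comm, hcN]; ring
  have h4 : 0 ≤ 2 * μ * (#Z * (μ * #S + #{p ∈ S | R p p}) - #S ^ 2 * (k + μ)) := by
    have : (#S : ℝ) ^ 2 * k ^ 2 = #S ^ 2 * (l * #Z + μ ^ 2) := by rw [hdesign]
    nlinarith
  have := nonneg_of_mul_nonneg_right h4 (by positivity)
  linarith

/-! ### Counting vectors and projective points -/

/-- If `P` is invariant under translation by multiples of `v`, and on each orbit of these translations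
inside `P` exactly one vector satisfies `φ`, then `φ` holds for one vector in `|F|` among those
satisfying `P`. -/
theorem card_mul_card_filter_eq_of_existsUnique_smul_add {F V : Type*} [Ring F] [Fintype F]
    [AddCommGroup V] [Module F V] [Fintype V] (P φ : V → Prop)
    [DecidablePred P] [DecidablePred φ] (v : V)
    (hP : ∀ z, P z → ∀ c : F, P (z + c • v))
    (hφ : ∀ z, P z → ∃! c : F, φ (z + c • v)) :
    Fintype.card F * #{z | P z ∧ φ z} = #{z | P z} := by
  classical
  rw [← Finset.card_univ, ← card_product]
  refine card_bij (fun a _ => a.2 + a.1 • v) ?_ ?_ ?_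
  · rintro ⟨c, z⟩ h
    simp only [mem_product, mem_filter, mem_univ, true_and] at h ⊢
    exact hP z h.1 c
  · rintro ⟨c, z⟩ h ⟨d, y⟩ h' e
    simp only [mem_product, mem_filter, mem_univ, true_and] at h h' e
    have hy : y = z + (c - d) • v := by
      rw [sub_smul, ← add_sub_assoc, e, add_sub_cancel_right]
    have h0 : c - d = 0 :=
      (hφ z h.1).unique (hy ▸ h'.2) (by simpa using h.2)
    rw [h0, zero_smul, add_zero] at hy
    rw [hy, sub_eq_zero.1 h0]
  · intro z hz
    simp only [mem_filter, mem_univ, true_and] at hz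
    obtain ⟨c, hc, -⟩ := hφ z hz
    exact ⟨(-c, z + c • v), by simpa using ⟨hP z hz c, hc⟩, by simp⟩

/-- A scale-invariant set of vectors that contains `0` consists of `0` and of `|F| - 1` vectors for
each of its projective points. -/
theorem card_projectivization_filter_rep {F V : Type*} [Field F] [Fintype F] [AddCommGroup V]
    [Module F V] [Fintype V] [Fintype (ℙ F V)] (P : V → Prop) [DecidablePred P] (h0 : P 0)
    (hP : ∀ (c : F) z, P z → P (c • z)) :
    #{p : ℙ F V | P p.rep} * (Fintype.card F - 1) + 1 = #{z | P z} := by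
  classical
  have h : #{z | P z} = #({z ∈ ({z | P z} : Finset V) | z ≠ 0}) + 1 := by
    rw [filter_ne' _ (0 : V), card_erase_add_one (by simpa using h0)]
  rw [h, ← Fintype.card_units, ← Finset.card_univ (α := Fˣ), ← card_product]
  congr 1
  refine card_bij (fun a _ => (a.2 : F) • a.1.rep) ?_ ?_ ?_
  · rintro ⟨p, c⟩ h
    simp only [mem_product, mem_filter, mem_univ, true_and, and_true] at h ⊢
    exact ⟨hP _ _ h, smul_ne_zero c.ne_zero p.rep_nonzero⟩
  · rintro ⟨p, c⟩ - ⟨r, d⟩ - e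
    simp only at e
    have hpr : p = r := by
      rw [← p.mk_rep, ← r.mk_rep, Projectivization.mk_eq_mk_iff]
      refine ⟨c⁻¹ * d, ?_⟩
      rw [mul_smul, Units.smul_def d, ← e]
      exact inv_smul_smul c _
    subst hpr
    rw [Units.ext (smul_left_injective F p.rep_nonzero e)]
  · intro z hz
    simp only [mem_filter, mem_univ, true_and] at hz
    obtain ⟨c, hc⟩ := Projectivization.exists_smul_eq_mk_rep F z hz.2
    refine ⟨(Projectivization.mk F z hz.2, c⁻¹), ?_, ?_⟩
    · simp only [mem_product, mem_filter, mem_univ, true_and, and_true]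
      rw [← hc]
      exact hP _ _ hz.1
    · simp only
      rw [← hc]
      exact inv_smul_smul c z

/-! ### Isotropic vectors -/

/-- The quadratic Gauss sum `∑ x, ψ (t * x ^ 2)` changes sign when `t` is multiplied by a nonsquare. -/
theorem sum_addChar_nonsquare_mul_sq {F : Type*} [Field F] [Fintype F] {R : Type*}
    [CommRing R] [IsDomain R] {ψ : AddChar F R} (hψ : ψ.IsPrimitive) (hF : ringChar F ≠ 2) {u t : F}
    (hu : ¬ IsSquare u) (ht : t ≠ 0) :
    ∑ x : F, ψ (u * t * x ^ 2) = -∑ x : F, ψ (t * x ^ 2) := by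
  classical
  -- Each `y` has `1 + χ y` square roots, where `χ` is the quadratic character.
  have hsum : ∀ s : F, ∑ x : F, ψ (s * x ^ 2) =
      ∑ y : F, ((quadraticChar F y + 1 : ℤ) : R) * ψ (s * y) := by
    intro s
    rw [← sum_fiberwise univ (fun x : F => x ^ 2)]
    refine sum_congr rfl fun y _ => ?_
    rw [sum_congr rfl (g := fun _ => ψ (s * y)) (by simp +contextual), sum_const, nsmul_eq_mul,
      ← quadraticChar_card_sqrts hF y]
    simp
  have hu0 : u ≠ 0 := by rintro rfl; exact hu IsSquare.zero
  have hχ : quadraticChar F u = -1 := quadraticChar_neg_one_iff_not_isSquare.2 hu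
  rw [hsum, hsum, eq_neg_iff_add_eq_zero]
  -- Substituting `y ↦ u * y` turns `χ` into `-χ`, so that the two sums add up to `2 * ∑ y, ψ (t * y)`.
  have hshift : ∑ y : F, ((quadraticChar F y + 1 : ℤ) : R) * ψ (u * t * y) =
      ∑ y : F, ((1 - quadraticChar F y : ℤ) : R) * ψ (t * y) := by
    refine Fintype.sum_equiv (Equiv.mulLeft₀ u hu0) _ _ fun y => ?_
    have hy : quadraticChar F (u * y) = -quadraticChar F y := by rw [map_mul, hχ, neg_one_mul]
    rw [Equiv.mulLeft₀_apply, hy]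
    ring_nf
  rw [hshift, ← sum_add_distrib]
  have h0 := AddChar.sum_mulShift t hψ
  rw [if_neg ht] at h0
  calc _ = ∑ y : F, 2 * ψ (y * t) := sum_congr rfl fun y _ => by push_cast; ring_nf
    _ = 0 := by rw [← mul_sum, h0]; simp

theorem card_dotProduct_self_eq_zero_of_ringChar_ne_two {F : Type*} [Field F]
    [Fintype F] [DecidableEq F] (hF : ringChar F ≠ 2) {n : ℕ} (hn : Odd n) :
    Fintype.card F * #{z : Fin n → F | z ⬝ᵥ z = 0} = Fintype.card F ^ n := by
  obtain ⟨u, hu⟩ := FiniteField.exists_nonsquare hF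
  have hu0 : u ≠ 0 := by rintro rfl; exact hu IsSquare.zero
  set ψ := AddChar.FiniteField.primitiveChar_to_Complex F with hψdef
  have hψ : ψ.IsPrimitive := AddChar.FiniteField.primitiveChar_to_Complex_isPrimitive F
  have hprod : ∀ t : F, ∑ z : Fin n → F, ψ (z ⬝ᵥ z * t) = (∑ x : F, ψ (t * x ^ 2)) ^ n := by
    intro t
    rw [← Fin.prod_const, prod_univ_sum, Fintype.piFinset_univ]
    refine sum_congr rfl fun z _ => ?_
    have hψsum : ∀ f : Fin n → F, ψ (∑ i, f i) = ∏ i, ψ (f i) := fun f =>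
      map_prod ψ.toMonoidHom (fun i => Multiplicative.ofAdd (f i)) univ
    rw [dotProduct, sum_mul, hψsum]
    exact prod_congr rfl fun i _ => by ring_nf
  have hcount : ((Fintype.card F * #{z : Fin n → F | z ⬝ᵥ z = 0} : ℕ) : ℂ) =
      ∑ t : F, (∑ x : F, ψ (t * x ^ 2)) ^ n := by
    simp_rw [← hprod]
    rw [sum_comm]
    have : ∀ z : Fin n → F, ∑ t : F, ψ (z ⬝ᵥ z * t) =
        Fintype.card F * if z ⬝ᵥ z = 0 then 1 else 0 := by
      intro z
      simp_rw [mul_comm (z ⬝ᵥ z)]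
      rw [AddChar.sum_mulShift _ hψ]
      split_ifs <;> simp
    simp_rw [this]
    rw [← mul_sum, sum_boole]
    push_cast
    rfl
  -- The terms with `t ≠ 0` cancel, as `n` is odd; the term `t = 0` is `|F| ^ n`.
  set h : F → ℂ := fun t => if t = 0 then 0 else (∑ x : F, ψ (t * x ^ 2)) ^ n with hh
  have hneg : ∀ t, h (u * t) = -h t := by
    intro t
    by_cases ht : t = 0
    · simp [hh, ht]
    · simp only [hh, ht, mul_eq_zero, hu0, or_self, if_false]
      rw [sum_addChar_nonsquare_mul_sq hψ hF hu ht, hn.neg_pow]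
  have hzero : ∑ t, h t = 0 := by
    have h1 : ∑ t, h (u * t) = ∑ t, h t := Equiv.sum_comp (Equiv.mulLeft₀ u hu0) h
    simp_rw [hneg] at h1
    rw [sum_neg_distrib] at h1
    exact self_eq_neg.1 h1.symm
  have htotal : ∑ t : F, (∑ x : F, ψ (t * x ^ 2)) ^ n = (Fintype.card F : ℂ) ^ n := by
    rw [← add_sum_erase _ _ (mem_univ 0)]
    have : ∑ t ∈ univ.erase 0, (∑ x : F, ψ (t * x ^ 2)) ^ n = 0 := by
      rw [← hzero, ← add_sum_erase _ h (mem_univ 0)]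
      simp only [hh, if_true, zero_add]
      exact sum_congr rfl fun t ht => by rw [if_neg (ne_of_mem_erase ht)]
    rw [this]
    simp
  rw [htotal] at hcount
  exact_mod_cast hcount

theorem dotProduct_self_eq_zero_iff_of_ringChar_eq_two {F : Type*} [Field F] {n : ℕ}
    (hF : ringChar F = 2) (z : Fin n → F) :
    z ⬝ᵥ z = 0 ↔ 1 ⬝ᵥ z = 0 := by
  have : CharP F 2 := ringChar.of_eq hF
  rw [one_dotProduct, ← sq_eq_zero_iff (a := ∑ i, z i), CharTwo.sum_sq]
  simp [dotProduct, sq]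

theorem one_dotProduct_one_of_ringChar_eq_two {F : Type*} [Field F] {n : ℕ}
    (hF : ringChar F = 2) (hn : Odd n) :
    (1 : Fin n → F) ⬝ᵥ 1 = 1 := by
  have : CharP F 2 := ringChar.of_eq hF
  obtain ⟨m, rfl⟩ := hn
  simp [one_dotProduct, CharTwo.two_eq_zero]

section Counting

variable {F : Type*} [Field F] [Fintype F] [DecidableEq F] {n : ℕ}

theorem card_mul_card_filter_dotProduct_eq_zero {P : (Fin n → F) → Prop} [DecidablePred P]
    {u v : Fin n → F} (huv : u ⬝ᵥ v ≠ 0) (hP : ∀ z, P z → ∀ c : F, P (z + c • v)) :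
    Fintype.card F * #{z | P z ∧ u ⬝ᵥ z = 0} = #{z | P z} := by
  refine card_mul_card_filter_eq_of_existsUnique_smul_add P _ v hP fun z _ => ?_
  refine ⟨-(u ⬝ᵥ z) / (u ⬝ᵥ v), ?_, fun c hc => ?_⟩
  · simp [dotProduct_add, dotProduct_smul, huv]
  · beta_reduce at hc
    rw [dotProduct_add, dotProduct_smul, smul_eq_mul] at hc
    rw [eq_div_iff huv]
    linear_combination hc

/-- If `w` is not a multiple of `u`, some vector orthogonal to `u` is not orthogonal to `w`. -/
theorem exists_dotProduct_eq_zero_and_ne_zero {u w : Fin n → F} (hu : u ≠ 0)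
    (hw : ∀ c : F, w ≠ c • u) : ∃ v, u ⬝ᵥ v = 0 ∧ w ⬝ᵥ v ≠ 0 := by
  obtain ⟨i, hi⟩ := Function.ne_iff.1 hu
  by_contra! h
  -- The vectors `u i • eⱼ - u j • eᵢ` are orthogonal to `u`; if all are orthogonal to `w`, then `w` is
  -- a multiple of `u`.
  refine hw (w i / u i) (funext fun j => ?_)
  have := h (u i • Pi.single j 1 - u j • Pi.single i 1) (by simp [dotProduct_sub, mul_comm])
  simp only [dotProduct_sub, dotProduct_smul, dotProduct_single_one, smul_eq_mul] at this
  rw [Pi.smul_apply, smul_eq_mul, div_mul_eq_mul_div, eq_div_iff hi]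
  linear_combination this

theorem card_mul_card_dotProduct_eq_zero {u : Fin n → F} (hu : u ≠ 0) :
    Fintype.card F * #{z : Fin n → F | u ⬝ᵥ z = 0} = Fintype.card F ^ n := by
  obtain ⟨v, hv⟩ : ∃ v, u ⬝ᵥ v ≠ 0 := by
    rw [ne_eq, ← dotProduct_eq_zero_iff, not_forall] at hu
    exact hu
  have := card_mul_card_filter_dotProduct_eq_zero (P := fun _ => True) hv fun _ _ _ => trivial
  simpa using this

theorem card_sq_mul_card_dotProduct_eq_zero {u w : Fin n → F} (hu : u ≠ 0)
    (hw : ∀ c : F, w ≠ c • u) :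
    Fintype.card F ^ 2 * #{z : Fin n → F | u ⬝ᵥ z = 0 ∧ w ⬝ᵥ z = 0} = Fintype.card F ^ n := by
  obtain ⟨v, huv, hwv⟩ := exists_dotProduct_eq_zero_and_ne_zero hu hw
  rw [sq, mul_assoc, card_mul_card_filter_dotProduct_eq_zero (P := fun z => u ⬝ᵥ z = 0) hwv,
    card_mul_card_dotProduct_eq_zero hu]
  intro z hz c
  rw [dotProduct_add, dotProduct_smul, huv, hz, smul_zero, add_zero]

/-- In odd dimension, `|F| ^ (n - 1)` vectors are isotropic. -/
theorem card_mul_card_dotProduct_self_eq_zero (hn : Odd n) :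
    Fintype.card F * #{z : Fin n → F | z ⬝ᵥ z = 0} = Fintype.card F ^ n := by
  by_cases hF : ringChar F = 2
  · simp_rw [dotProduct_self_eq_zero_iff_of_ringChar_eq_two hF]
    refine card_mul_card_dotProduct_eq_zero fun h => ?_
    have := one_dotProduct_one_of_ringChar_eq_two hF hn
    simp [h] at this
  · exact card_dotProduct_self_eq_zero_of_ringChar_ne_two hF hn

/-- In odd dimension, `|F| ^ (n - 2)` isotropic vectors are orthogonal to a given isotropic `x ≠ 0`. -/
theorem card_sq_mul_card_isotropic_perp (hn : Odd n) {x : Fin n → F} (hx : x ≠ 0)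
    (hxx : x ⬝ᵥ x = 0) :
    Fintype.card F ^ 2 * #{z : Fin n → F | z ⬝ᵥ z = 0 ∧ x ⬝ᵥ z = 0} = Fintype.card F ^ n := by
  by_cases hF : ringChar F = 2
  -- In characteristic two, this is the number of solutions of two linear equations, which are
  -- independent because `1` is not isotropic.
  · have h11 := one_dotProduct_one_of_ringChar_eq_two hF hn
    have hx1 := (dotProduct_self_eq_zero_iff_of_ringChar_eq_two hF x).1 hxx
    simp_rw [dotProduct_self_eq_zero_iff_of_ringChar_eq_two hF]
    refine card_sq_mul_card_dotProduct_eq_zero (fun h => by simp [h] at h11) ?_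
    rintro c rfl
    rw [dotProduct_smul, h11, smul_eq_mul, mul_one] at hx1
    exact hx (by rw [hx1, zero_smul])
  · have h2 : (2 : F) ≠ 0 := Ring.two_ne_zero hF
    have hself : ∀ (z : Fin n → F) (c : F),
        (z + c • x) ⬝ᵥ (z + c • x) = z ⬝ᵥ z + c * (2 * (x ⬝ᵥ z)) := by
      intro z c
      simp only [dotProduct_add, add_dotProduct, dotProduct_smul, smul_dotProduct, hxx,
        dotProduct_comm z x, smul_eq_mul]
      ring
    -- A line `z + F x` with `x ⬝ᵥ z ≠ 0` contains exactly one isotropic vector.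
    have hoff : Fintype.card F * #{z : Fin n → F | x ⬝ᵥ z ≠ 0 ∧ z ⬝ᵥ z = 0} =
        #{z : Fin n → F | x ⬝ᵥ z ≠ 0} := by
      refine card_mul_card_filter_eq_of_existsUnique_smul_add (F := F) _ _ x ?_ ?_
      · intro z hz c
        rwa [dotProduct_add, dotProduct_smul, hxx, smul_zero, add_zero]
      · intro z hz
        have hd : 2 * (x ⬝ᵥ z) ≠ 0 := mul_ne_zero h2 hz
        refine ⟨-(z ⬝ᵥ z) / (2 * (x ⬝ᵥ z)), ?_, fun c hc => ?_⟩
        · simp only [hself]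
          rw [div_mul_cancel₀ _ hd, add_neg_cancel]
        · beta_reduce at hc
          rw [hself] at hc
          rw [eq_div_iff hd]
          linear_combination hc
    have hall := card_mul_card_dotProduct_self_eq_zero (F := F) hn
    have hperp := card_mul_card_dotProduct_eq_zero hx
    have hsplit := card_filter_add_card_filter_not (s := (univ : Finset (Fin n → F)))
      (fun z => x ⬝ᵥ z = 0)
    have hsplit' := card_filter_add_card_filter_not (s := ({z | z ⬝ᵥ z = 0} : Finset (Fin n → F)))
      (fun z => x ⬝ᵥ z = 0)
    rw [filter_filter, filter_filter] at hsplit'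
    have hcomm : #{z : Fin n → F | z ⬝ᵥ z = 0 ∧ ¬x ⬝ᵥ z = 0} =
        #{z : Fin n → F | x ⬝ᵥ z ≠ 0 ∧ z ⬝ᵥ z = 0} := by
      congr 1; ext z; simp [and_comm]
    rw [hcomm] at hsplit'
    rw [card_univ, Fintype.card_fun, Fintype.card_fin] at hsplit
    zify at *
    linear_combination (Fintype.card F : ℤ) ^ 2 * hsplit' - Fintype.card F * hoff
      + Fintype.card F * hall + hperp - Fintype.card F * hsplit

/-- In odd dimension, `|F| ^ (n - 3)` isotropic vectors are orthogonal to `x` and `y`, if `x` is isotropic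
and not orthogonal to `y`: translation by `x` preserves the isotropic vectors in `xᗮ`. -/
theorem card_cube_mul_card_isotropic_perp_perp (hn : Odd n) {x y : Fin n → F}
    (hxx : x ⬝ᵥ x = 0) (hxy : x ⬝ᵥ y ≠ 0) :
    Fintype.card F ^ 3 * #{z : Fin n → F | z ⬝ᵥ z = 0 ∧ x ⬝ᵥ z = 0 ∧ y ⬝ᵥ z = 0} =
      Fintype.card F ^ n := by
  have hx : x ≠ 0 := by rintro rfl; simp at hxy
  rw [pow_succ, mul_assoc]
  simp_rw [← and_assoc]
  rw [card_mul_card_filter_dotProduct_eq_zero (v := x) (by rwa [dotProduct_comm]),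
    card_sq_mul_card_isotropic_perp hn hx hxx]
  rintro z ⟨hz, hxz⟩ c
  simp [dotProduct_add, add_dotProduct, hz, hxz, hxx, dotProduct_comm z x]

end Counting

/-! ### Pairwise non-orthogonal points -/

section Projective

variable {F : Type*} [Field F] [Fintype F] [DecidableEq F] {n : ℕ}

/-- The ratio bound for pairwise non-orthogonal points in the projective set defined by `P`, with the
design parameters given as numbers of vectors. -/
theorem card_sq_mul_le_of_pairwise_dotProduct_ne_zero (P : (Fin n → F) → Prop)
    [DecidablePred P] (h0 : P 0) (hP : ∀ (c : F) z, P z → P (c • z)) {μ : ℝ} (hμ : 1 ≤ μ)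
    (S : Finset (ℙ F (Fin n → F))) (hSP : ∀ p ∈ S, P p.rep)
    (hN : (#{z | P z} : ℝ) = Fintype.card F ^ 2 * μ ^ 2)
    (hk : ∀ p ∈ S, (#{z | P z ∧ p.rep ⬝ᵥ z = 0} : ℝ) = Fintype.card F * μ ^ 2)
    (hl : ∀ p ∈ S, ∀ r ∈ S, p ≠ r →
      (#{z | P z ∧ p.rep ⬝ᵥ z = 0 ∧ r.rep ⬝ᵥ z = 0} : ℝ) = μ ^ 2)
    (hS : ∀ p ∈ S, ∀ r ∈ S, p ≠ r → p.rep ⬝ᵥ r.rep ≠ 0) :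
    (#S : ℝ) ^ 2 * (μ + 1) ≤
      (Fintype.card F * μ + 1) * (μ * #S + #{p ∈ S | p.rep ⬝ᵥ p.rep = 0}) := by
  classical
  have : Fintype (ℙ F (Fin n → F)) := Fintype.ofFinite _
  set q : ℝ := (Fintype.card F : ℝ) with hq
  have hq1 : 1 < q := by rw [hq]; exact_mod_cast Fintype.one_lt_card (α := F)
  have hq0 : q - 1 ≠ 0 := by linarith
  have hcard : ∀ (T : (Fin n → F) → Prop) [DecidablePred T], T 0 → (∀ (c : F) z, T z → T (c • z)) →
      (#{p : ℙ F (Fin n → F) | T p.rep} : ℝ) = (#{z | T z} - 1) / (q - 1) := by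
    intro T _ hT0 hT
    rw [eq_div_iff hq0, ← card_projectivization_filter_rep T hT0 hT]
    push_cast [Nat.cast_pred (Fintype.card_pos (α := F))]
    ring
  have hsmul : ∀ (x : Fin n → F) (c : F) z, x ⬝ᵥ z = 0 → x ⬝ᵥ (c • z) = 0 := by
    intro x c z h
    rw [dotProduct_smul, h, smul_zero]
  have main := independent_set_weighted_ratio_bound ({p | P p.rep} : Finset (ℙ F (Fin n → F))) S
    (fun p hp => by simpa using hSP p hp) (fun p z => p.rep ⬝ᵥ z.rep = 0)
    (k := (q * μ ^ 2 - 1) / (q - 1)) (l := (μ ^ 2 - 1) / (q - 1))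
    (one_pos.trans_le hμ) ?_ ?_ hS ?_ ?_
  · rw [hcard P h0 hP, hN] at main
    have e1 : (q * μ ^ 2 - 1) / (q - 1) + μ = (μ + 1) * ((q * μ - 1) / (q - 1)) := by
      field_simp; ring
    have e2 : (q ^ 2 * μ ^ 2 - 1) / (q - 1) = (q * μ + 1) * ((q * μ - 1) / (q - 1)) := by
      field_simp; ring
    rw [e1, e2] at main
    have hD : 0 < (q * μ - 1) / (q - 1) := div_pos (by nlinarith) (by linarith)
    refine le_of_mul_le_mul_right ?_ hD
    linarith
  · intro p hp
    rw [filter_filter, hcard (fun z => P z ∧ p.rep ⬝ᵥ z = 0) ⟨h0, dotProduct_zero _⟩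
      fun c z h => ⟨hP c z h.1, hsmul _ c z h.2⟩, hk p hp]
  · intro p hp r hr hpr
    rw [filter_filter, hcard (fun z => P z ∧ p.rep ⬝ᵥ z = 0 ∧ r.rep ⬝ᵥ z = 0)
      ⟨h0, dotProduct_zero _, dotProduct_zero _⟩
      fun c z h => ⟨hP c z h.1, hsmul _ c z h.2.1, hsmul _ c z h.2.2⟩, hl p hp r hr hpr]
  · field_simp; ring
  · rw [hcard P h0 hP, hN]; field_simp; ring

/-- In odd dimension `n`, at most `|F| ^ ((n - 1) / 2) + 1` isotropic points are pairwise non-orthogonal.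
In terms of polar spaces, this bounds the partial ovoids of a parabolic quadric (odd
characteristic) or of a symplectic space (characteristic two). -/
theorem card_le_of_isotropic_of_pairwise_dotProduct_ne_zero {m : ℕ}
    (S : Finset (ℙ F (Fin (2 * m + 3) → F))) (hS0 : ∀ p ∈ S, p.rep ⬝ᵥ p.rep = 0)
    (hS : ∀ p ∈ S, ∀ r ∈ S, p ≠ r → p.rep ⬝ᵥ r.rep ≠ 0) :
    (#S : ℝ) ≤ (Fintype.card F : ℝ) ^ (m + 1) + 1 := by
  have hn : Odd (2 * m + 3) := ⟨m + 1, by ring⟩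
  have hq : 0 < (Fintype.card F : ℝ) := by exact_mod_cast Fintype.card_pos (α := F)
  have main := card_sq_mul_le_of_pairwise_dotProduct_ne_zero (fun z => z ⬝ᵥ z = 0) (by simp)
    (fun c z h => by simp [h]) (μ := (Fintype.card F : ℝ) ^ m)
    (one_le_pow₀ (by exact_mod_cast Fintype.card_pos (α := F))) S hS0 ?_ ?_ ?_ hS
  · rw [filter_true_of_mem hS0] at main
    rcases (#S).eq_zero_or_pos with h | h
    · rw [h, Nat.cast_zero]; positivity
    · have h' : (0 : ℝ) < #S * ((Fintype.card F : ℝ) ^ m + 1) := by positivity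
      refine le_of_mul_le_mul_right ?_ h'
      calc _ = (#S : ℝ) ^ 2 * ((Fintype.card F : ℝ) ^ m + 1) := by ring
        _ ≤ _ := main
        _ = _ := by ring
  · have := card_mul_card_dotProduct_self_eq_zero (F := F) hn
    refine mul_left_cancel₀ hq.ne' ?_
    calc _ = (Fintype.card F : ℝ) ^ (2 * m + 3) := by exact_mod_cast this
      _ = _ := by ring
  · intro p hp
    have := card_sq_mul_card_isotropic_perp hn p.rep_nonzero (hS0 p hp)
    refine mul_left_cancel₀ (pow_ne_zero 2 hq.ne') ?_
    calc _ = (Fintype.card F : ℝ) ^ (2 * m + 3) := by exact_mod_cast this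
      _ = _ := by ring
  · intro p hp r hr hpr
    have := card_cube_mul_card_isotropic_perp_perp hn (hS0 p hp) (hS p hp r hr hpr)
    refine mul_left_cancel₀ (pow_ne_zero 3 hq.ne') ?_
    calc _ = (Fintype.card F : ℝ) ^ (2 * m + 3) := by exact_mod_cast this
      _ = _ := by ring

/-- The ratio bound for pairwise non-orthogonal points of the whole projective space, where `μ` is
`|F| ^ ((n - 2) / 2)`. -/
theorem card_sq_mul_le_of_pairwise_dotProduct_ne_zero_of_sq_eq {μ : ℝ} (hμ : 1 ≤ μ)
    (hμn : (Fintype.card F : ℝ) ^ 2 * μ ^ 2 = Fintype.card F ^ n)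
    (S : Finset (ℙ F (Fin n → F)))
    (hS : ∀ p ∈ S, ∀ r ∈ S, p ≠ r → p.rep ⬝ᵥ r.rep ≠ 0) :
    (#S : ℝ) ^ 2 * (μ + 1) ≤
      (Fintype.card F * μ + 1) * (μ * #S + #{p ∈ S | p.rep ⬝ᵥ p.rep = 0}) := by
  have hq : 0 < (Fintype.card F : ℝ) := by exact_mod_cast Fintype.card_pos (α := F)
  refine card_sq_mul_le_of_pairwise_dotProduct_ne_zero (fun _ => True) trivial
    (fun _ _ _ => trivial) hμ S (fun _ _ => trivial) ?_ ?_ ?_ hS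
  · simp [hμn]
  · intro p hp
    simp only [true_and]
    refine mul_left_cancel₀ hq.ne' ?_
    calc _ = (Fintype.card F : ℝ) ^ n := by
          exact_mod_cast card_mul_card_dotProduct_eq_zero p.rep_nonzero
      _ = _ := by rw [← hμn]; ring
  · intro p hp r hr hpr
    simp only [true_and]
    refine mul_left_cancel₀ (pow_ne_zero 2 hq.ne') ?_
    rw [hμn]
    have hne : ∀ c : F, r.rep ≠ c • p.rep := by
      intro c hc
      apply hpr
      rw [← p.mk_rep, ← r.mk_rep, eq_comm, Projectivization.mk_eq_mk_iff']
      exact ⟨c, hc.symm⟩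
    exact_mod_cast card_sq_mul_card_dotProduct_eq_zero p.rep_nonzero hne

end Projective

/-! ### The independence number of the orthogonality graph -/

/-- The final estimate, with `r = √q`, `s` the size of an independent set and `a` the number of its
isotropic points: the quadratic inequality for `s` fails beyond the claimed bound. -/
theorem le_of_sq_mul_le_of_le {r μ s a : ℝ} (hr : 1 ≤ r) (hμ : r ^ 3 ≤ μ)
    (ha : a ≤ r * μ + 1) (h : s ^ 2 * (μ + 1) ≤ (r ^ 2 * μ + 1) * (μ * s + a)) :
    s ≤ r ^ 2 * μ - r ^ 2 + r + 2 := by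
  by_contra! hs
  set T := r ^ 2 * μ - r ^ 2 + r + 2 with hT
  have hr2 : 1 ≤ r ^ 2 := one_le_pow₀ hr
  have hμ1 : 1 ≤ μ := (one_le_pow₀ hr).trans hμ
  have hT0 : 0 < T := by nlinarith
  have hD : T * (μ + 1) - (r ^ 2 * μ + 1) * μ = (r + 1) * (μ + 1) - r ^ 2 + 1 := by
    rw [hT]; ring
  have hr3 : r ^ 2 ≤ r ^ 3 := pow_le_pow_right₀ hr (by norm_num)
  have hD0 : 0 < (r + 1) * (μ + 1) - r ^ 2 + 1 := by nlinarith
  have hkey : (r ^ 2 * μ + 1) * (r * μ + 1) < T * ((r + 1) * (μ + 1) - r ^ 2 + 1) := by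
    have h4 : r ^ 4 ≤ r ^ 2 * μ := by
      calc r ^ 4 ≤ r ^ 2 * r ^ 3 := by
            rw [← pow_add]; exact pow_le_pow_right₀ hr (by norm_num)
        _ ≤ r ^ 2 * μ := by gcongr
    have e : T * ((r + 1) * (μ + 1) - r ^ 2 + 1) - (r ^ 2 * μ + 1) * (r * μ + 1) =
        μ * ((r ^ 2 * μ - r ^ 4) + r ^ 2 + 2 * r + 2) + (r + 2 - r ^ 2) ^ 2 - 1 := by
      rw [hT]; ring
    nlinarith [mul_nonneg (by linarith : (0:ℝ) ≤ μ) (sub_nonneg.2 h4), sq_nonneg (r + 2 - r ^ 2),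
      mul_nonneg (by linarith : (0:ℝ) ≤ μ) (by linarith : (0:ℝ) ≤ r)]
  have h1 : T * ((r + 1) * (μ + 1) - r ^ 2 + 1) ≤ s * (s * (μ + 1) - (r ^ 2 * μ + 1) * μ) := by
    rw [← hD]
    refine mul_le_mul hs.le ?_ (by rw [hD]; exact hD0.le) (hT0.trans hs).le
    have := mul_le_mul_of_nonneg_right hs.le (by linarith : 0 ≤ μ + 1)
    linarith
  have h2 : (r ^ 2 * μ + 1) * a ≤ (r ^ 2 * μ + 1) * (r * μ + 1) := by
    gcongr
  nlinarith

theorem mainTheorem3 (F : Type*) [Field F] [Fintype F] (q : ℕ) (hq : Fintype.card F = q)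
    (n : ℕ) (hn : 4 < n) (hodd : Odd n) :
    ((orthogonalityGraph F n).indepNum : ℝ) ≤
      (q : ℝ) ^ ((n : ℝ) / 2) - (q : ℝ) + Real.sqrt (q : ℝ) + 2 := by
  classical
  obtain ⟨m, rfl⟩ : ∃ m, n = 2 * m + 3 := by
    obtain ⟨j, rfl⟩ := hodd
    exact ⟨j - 1, by omega⟩
  subst hq
  obtain ⟨S, hS, hcard⟩ := orthogonalityGraph_exists_indepNum F (2 * m + 3)
  rw [← hcard]
  have hind : ∀ p ∈ S, ∀ t ∈ S, p ≠ t → p.rep ⬝ᵥ t.rep ≠ 0 := by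
    intro p hp t ht hpt h
    refine hS hp ht hpt ⟨hpt, ?_⟩
    rw [← p.mk_rep, ← t.mk_rep]
    exact h
  set r := √(Fintype.card F : ℝ) with hr
  have hr2 : r ^ 2 = Fintype.card F := Real.sq_sqrt (Nat.cast_nonneg _)
  have hr1 : 1 ≤ r := Real.one_le_sqrt.2 (by exact_mod_cast Fintype.card_pos (α := F))
  have hr0 : 0 < r := one_pos.trans_le hr1
  have hbound := card_sq_mul_le_of_pairwise_dotProduct_ne_zero_of_sq_eq
    (μ := r ^ (2 * m + 1)) (one_le_pow₀ hr1) (by rw [← hr2]; ring) S hind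
  have hiso := card_le_of_isotropic_of_pairwise_dotProduct_ne_zero {p ∈ S | p.rep ⬝ᵥ p.rep = 0}
    (fun p hp => (mem_filter.1 hp).2)
    (fun p hp t ht => hind p (mem_filter.1 hp).1 t (mem_filter.1 ht).1)
  rw [← hr2] at hbound hiso
  have hfinal := le_of_sq_mul_le_of_le hr1 (pow_le_pow_right₀ hr1 (by omega))
    (hiso.trans_eq (by ring)) hbound
  have hrpow : (Fintype.card F : ℝ) ^ (((2 * m + 3 : ℕ) : ℝ) / 2) = r ^ 2 * r ^ (2 * m + 1) := by
    rw [← pow_add, hr, Real.sqrt_eq_rpow, ← Real.rpow_natCast, ← Real.rpow_mul (Nat.cast_nonneg _)]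
    congr 1
    push_cast
    ring
  rw [hrpow, ← hr2]
  exact hfinal
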